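/- Let $(L|K,v)$ be an extension of valued fields: $v$ is a (Krull) valuation on $L$, written additively, and $K$ carries its restriction. Denote the valuation rings by $\mathcal{O}_L$ and $\mathcal{O}_K$, the value groups by $vL$ and $vK$, and the residue fields by $Lv$ and $Kv$. Assume that $(L|K,v)$ is a defect extension, that is, $L|K$ is finite, $v$ is (up to equivalence) the unique extension to $L$ of its restriction to $K$, and in the equation $$[L:K]=q^{\nu}\cdot(vL:vK)\cdot[Lv:Kv],$$ with $q$ the characteristic exponent of $Kv$ and $\nu\ge 0$ an integer, the defect $q^{\nu}$ is greater than $1$. For every $\gamma\in vK$ fix an element $t_\gamma\in K$ with $v(t_\gamma)=-\gamma$. Let $p$ be a prime. 1) Assume that $K$ has characteristic $p$ and that $L|K$ is an Artin--Schreier extension, i.e. Galois of degree $p$. An Artin--Schreier generator is an element $\vartheta\in L$ with $L=K(\vartheta)$ and $\vartheta^p-\vartheta\in K$. Let $\vartheta$ be an Artin--Schreier generator, and for $c\in K$ put $\vartheta_c=t_{v(\vartheta-c)}(\vartheta-c)$. Then the rings $\mathcal{O}_K[\vartheta_c]$, $c\in K$, form a chain under inclusion whose union is $\mathcal{O}_L$.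 Likewise, the rings $\mathcal{O}_K[t_{v(\vartheta')}\vartheta']$, where $\vartheta'$ runs through all Artin--Schreier generators of $L|K$, form a chain under inclusion whose union is $\mathcal{O}_L$. For all $c_1,c_2\in K$, $$\mathcal{O}_K[\vartheta_{c_1}]\subsetneq\mathcal{O}_K[\vartheta_{c_2}]\iff v(\vartheta-c_1)<v(\vartheta-c_2).$$ 2) Assume that $L|K$ is a Kummer extension of degree $p$, i.e. $K$ contains a primitive $p$-th root of unity and $L|K$ is Galois of degree $p$. Let $\eta\in L$ be a Kummer generator (that is, $L=K(\eta)$ and $\eta^p\in K$) which is a $1$-unit (that is, $v(\eta-1)>0$), and for $c\in K$ put $\eta_c=t_{v(\eta-c)}(\eta-c)$. Then the rings $\mathcal{O}_K[\eta_c]$, where $c$ runs through all $1$-units of $K$, form a chain under inclusion whose union is $\mathcal{O}_L$. For all $1$-units $c_1,c_2\in K$, $$\mathcal{O}_K[\eta_{c_1}]\subsetneq\mathcal{O}_K[\eta_{c_2}]\iff v(\eta-c_1)<v(\eta-c_2).$$ -/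

import Mathlib

open scoped IntermediateField

namespace DefectExtension

section Valued

variable (K : Type*) {L Γ₀ : Type*} [Field K] [Field L] [Algebra K L]
  [LinearOrderedCommGroupWithZero Γ₀] (v : Valuation L Γ₀)

/-- The restriction to `K` of a valuation `v` on an extension field `L`. -/
abbrev restrictVal : Valuation K Γ₀ := v.comap (algebraMap K L)

instance restrictVal_hasExtension : (restrictVal K v).HasExtension v where
  val_isEquiv_comap := Valuation.IsEquiv.refl

/-- The ramification index `(vL : vK)`, with the convention that an infinite index is `0`. -/
noncomputable def ramificationIndex : ℕ :=
  (MonoidWithZeroHom.valueGroup (restrictVal K v).toMonoidWithZeroHom).relIndex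
    (MonoidWithZeroHom.valueGroup v.toMonoidWithZeroHom)

/-- The residue degree `[Lv : Kv]`, with the convention that an infinite degree is `0`. -/
noncomputable def residueDegree : ℕ :=
  Module.finrank (IsLocalRing.ResidueField (restrictVal K v).valuationSubring)
    (IsLocalRing.ResidueField v.valuationSubring)

/-- `(L|K,v)` is unibranched: `v` is, up to equivalence, the only extension to `L` of its
restriction to `K`. Valuations up to equivalence are given by their valuation rings. -/
def IsUnibranched : Prop :=
  ∀ A : ValuationSubring L,
    A.comap (algebraMap K L) = (restrictVal K v).valuationSubring → A = v.valuationSubring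

/-- `(L|K,v)` is a defect extension: it is finite and unibranched, and in the equation
`[L : K] = q ^ ν * (vL : vK) * [Lv : Kv]`, where `q` is the characteristic exponent of the
residue field `Kv`, the defect `q ^ ν` is greater than `1`. -/
def IsDefectExtension : Prop :=
  FiniteDimensional K L ∧ IsUnibranched K v ∧
    ∃ ν : ℕ,
      Module.finrank K L =
        ringExpChar (IsLocalRing.ResidueField (restrictVal K v).valuationSubring) ^ ν *
          (ramificationIndex K v * residueDegree K v) ∧
      1 < ringExpChar (IsLocalRing.ResidueField (restrictVal K v).valuationSubring) ^ ν

/-- A family `t` in `K` indexed by values such that `t γ` has value `-γ` (in multiplicative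
notation, `γ⁻¹`) for every `γ` in the value group `vK`. -/
def IsValueSection (t : Γ₀ → K) : Prop :=
  ∀ a : K, a ≠ 0 → restrictVal K v (t (restrictVal K v a)) = (restrictVal K v a)⁻¹

/-- The subring `𝒪_K[x]` of `L` generated by the valuation ring `𝒪_K` of `K` and `x`. -/
def ringAdjoin (x : L) : Subring L :=
  (Algebra.adjoin (restrictVal K v).valuationSubring {x}).toSubring

/-- For `t` as in `IsValueSection`: the ring `𝒪_K[t_{v(x)} x]`. -/
def normRing (t : Γ₀ → K) (x : L) : Subring L :=
  ringAdjoin K v (algebraMap K L (t (v x)) * x)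

end Valued

/-- `u` is a 1-unit: `u = 1 + b` with `b` in the maximal ideal. -/
def IsOneUnit {F Γ₀ : Type*} [Field F] [LinearOrderedCommGroupWithZero Γ₀]
    (v : Valuation F Γ₀) (u : F) : Prop :=
  v (u - 1) < 1

section Generators

variable (p : ℕ) (K L : Type*) [Field K] [Field L] [Algebra K L]

/-- `L|K` is an Artin-Schreier extension: Galois of degree `p = char K`, a prime. -/
structure IsArtinSchreierExtension : Prop where
  prime : p.Prime
  charP : CharP K p
  isGalois : IsGalois K L
  finrank_eq : Module.finrank K L = p

/-- `L|K` is a Kummer extension of prime degree `p`: Galois of degree `p`, where `K` contains a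
primitive `p`-th root of unity (so that `char K ≠ p`). -/
structure IsKummerExtension : Prop where
  prime : p.Prime
  exists_root : ∃ ζ : K, IsPrimitiveRoot ζ p
  isGalois : IsGalois K L
  finrank_eq : Module.finrank K L = p

variable {L}

/-- `ϑ` generates `L|K` and is a root of a polynomial `X ^ p - X - b` with `b ∈ K`. -/
def IsArtinSchreierGenerator (ϑ : L) : Prop :=
  K⟮ϑ⟯ = ⊤ ∧ ∃ b : K, ϑ ^ p - ϑ = algebraMap K L b

/-- `η` generates `L|K` and `η ^ p ∈ K`. -/
def IsKummerGenerator (η : L) : Prop :=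
  K⟮η⟯ = ⊤ ∧ ∃ a : K, η ^ p = algebraMap K L a

end Generators

end DefectExtension

/-! Values are multiplicative here, so a better approximation has a smaller value `v (x - c)`. As
`[L:K]` is prime and the defect exceeds `1`, the defect equation leaves ramification index and
residue degree equal to `1`: the extension is immediate. Hence no generator `x` has a best
approximation in `K`. Uniqueness of the extension makes `v` Galois invariant, so the minimal
polynomial `g` of `x` satisfies `v (g c) = v (x - c) ^ p`, where `p = [L:K]`.

The core is that a nonzero polynomial `f` of degree below `p` has eventually constant value as `c`
approaches `x` (`isMonomial_zero_of_natDegree_lt`). A counterexample of least degree `d` would have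
values of exponent `j` with `1 ≤ j ≤ d`. Division with remainder by it gives `g` an exponent `i * j`
with `i * d ≤ p`. As this exponent is `p`, `d` divides `p`, so `d = 1`, and linear polynomials are
no counterexample.

Therefore the nonzero Taylor terms of `f` at `c` have distinct exponents, do not tie near `x`, and
are each bounded by `v (f x)`. If `z = f x` is integral, every term lies in the ring generated by
the normalized `x - c`, and so does `z`; this gives the unions. Inclusions compare normalized
translates of one generator: the linear coefficient relating two of them is integral exactly when
the values are in the right order. Artin-Schreier generators are all of the form `k * (ϑ - c)` with
`v k = 1`, and a `c` closer to `η` than `1` is automatically a 1-unit. -/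

namespace DefectExtension

open Filter Polynomial

/-! ### Asymptotic values along approximations to an element -/

section Approximation

variable {K L Γ₀ : Type*} [Field K] [Field L] [Algebra K L]
  [LinearOrderedCommGroupWithZero Γ₀]

/-- The filter on `K` of approximations to `x`. -/
def approxFilter (K : Type*) {L Γ₀ : Type*} [Field K] [Field L] [Algebra K L]
    [LinearOrderedCommGroupWithZero Γ₀] (v : Valuation L Γ₀) (x : L) : Filter K :=
  ⨅ c₀ : K, 𝓟 {c | v (x - algebraMap K L c) ≤ v (x - algebraMap K L c₀)}

/-- The values `v (x - c)`, `c ∈ K`, have no best approximation. -/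
def HasNoBestApprox (K : Type*) {L Γ₀ : Type*} [Field K] [Field L] [Algebra K L]
    [LinearOrderedCommGroupWithZero Γ₀] (v : Valuation L Γ₀) (x : L) : Prop :=
  ∀ c : K, ∃ c' : K, v (x - algebraMap K L c') < v (x - algebraMap K L c)

/-- Near `x`, the value of `u c` is a constant times `v (x - c) ^ e`. -/
def IsMonomial (v : Valuation L Γ₀) (x : L) (u : K → L) (e : ℕ) : Prop :=
  ∃ β : Γ₀, β ≠ 0 ∧ ∀ᶠ c in approxFilter K v x, v (u c) = β * v (x - algebraMap K L c) ^ e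

variable {v : Valuation L Γ₀} {x : L}

theorem mem_approxFilter_iff {s : Set K} : s ∈ approxFilter K v x ↔
    ∃ c₀ : K, ∀ c : K, v (x - algebraMap K L c) ≤ v (x - algebraMap K L c₀) → c ∈ s := by
  rw [approxFilter, mem_iInf_of_directed]
  · simp only [mem_principal]
    rfl
  · intro a b
    rcases le_total (v (x - algebraMap K L a)) (v (x - algebraMap K L b)) with h | h
    · exact ⟨a, le_refl _, by
        simp only [ge_iff_le, le_principal_iff, mem_principal]
        exact fun c hc => le_trans hc h⟩
    · exact ⟨b, by
        simp only [ge_iff_le, le_principal_iff, mem_principal]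
        exact fun c hc => le_trans hc h, le_refl _⟩

instance : (approxFilter K v x).NeBot := by
  refine ⟨fun h => ?_⟩
  obtain ⟨c₀, h₀⟩ := mem_approxFilter_iff.1 (empty_mem_iff_bot.2 h)
  exact h₀ c₀ le_rfl

theorem HasNoBestApprox.eventually_lt (hx : HasNoBestApprox K v x) (c₀ : K) :
    ∀ᶠ c in approxFilter K v x, v (x - algebraMap K L c) < v (x - algebraMap K L c₀) := by
  obtain ⟨c₁, h₁⟩ := hx c₀
  exact mem_approxFilter_iff.2 ⟨c₁, fun c hc => lt_of_le_of_lt hc h₁⟩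

theorem HasNoBestApprox.sub_pos (hx : HasNoBestApprox K v x) (c : K) :
    0 < v (x - algebraMap K L c) := by
  obtain ⟨c₁, h₁⟩ := hx c
  exact lt_of_le_of_lt zero_le h₁

/-- The quotient of the higher power by the lower one strictly decreases with `v (x - c)`. Either it
never drops to the threshold, or it does at some `c₀` and lies strictly below it at every strictly
better `c`. -/
theorem HasNoBestApprox.eventually_lt_or_gt (hx : HasNoBestApprox K v x) {β β' : Γ₀}
    (hβ' : β' ≠ 0) {e e' : ℕ} (he : e < e') :
    (∀ᶠ c in approxFilter K v x,
        β * v (x - algebraMap K L c) ^ e < β' * v (x - algebraMap K L c) ^ e') ∨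
      ∀ᶠ c in approxFilter K v x,
        β' * v (x - algebraMap K L c) ^ e' < β * v (x - algebraMap K L c) ^ e := by
  by_cases h : ∃ c₀ : K, β' * v (x - algebraMap K L c₀) ^ e' ≤ β * v (x - algebraMap K L c₀) ^ e
  · right
    obtain ⟨c₀, h₀⟩ := h
    filter_upwards [hx.eventually_lt c₀] with c hc
    obtain ⟨k, rfl⟩ := Nat.exists_eq_add_of_lt he
    have key : ∀ c : K, β' * v (x - algebraMap K L c) ^ (e + k + 1) =
        (β' * v (x - algebraMap K L c) ^ (k + 1)) * v (x - algebraMap K L c) ^ e := by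
      intro c; rw [mul_assoc, ← pow_add]; congr 2; ring
    rw [key] at h₀ ⊢
    have h1 := le_of_mul_le_mul_right h₀ (pow_pos (hx.sub_pos c₀) e)
    refine mul_lt_mul_of_pos_right (lt_of_lt_of_le ?_ h1) (pow_pos (hx.sub_pos c) e)
    exact mul_lt_mul_of_pos_left (pow_lt_pow_left₀ hc zero_le (Nat.succ_ne_zero k))
      (zero_lt_iff.2 hβ')
  · left
    push Not at h
    exact Eventually.of_forall h

theorem IsMonomial.exponent_unique (hx : HasNoBestApprox K v x) {u : K → L} {e e' : ℕ}
    (h : IsMonomial v x u e) (h' : IsMonomial v x u e') : e = e' := by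
  wlog hlt : e < e' generalizing e e'
  · rcases lt_trichotomy e e' with h1 | h1 | h1
    · exact this h h' h1
    · exact h1
    · exact (this h' h h1).symm
  exfalso
  obtain ⟨β, -, h⟩ := h
  obtain ⟨β', hβ', h'⟩ := h'
  rcases hx.eventually_lt_or_gt (β := β) hβ' hlt with h2 | h2
  · obtain ⟨c, h3, h4, h5⟩ := (h.and (h'.and h2)).exists
    exact h5.ne (h3.symm.trans h4)
  · obtain ⟨c, h3, h4, h5⟩ := (h.and (h'.and h2)).exists
    exact h5.ne (h4.symm.trans h3)

/-- Different exponents exclude ties near `x`, so the ultrametric inequality becomes an equality.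
Which summand dominates depends on the constants and on how close the approximations come. -/
theorem IsMonomial.add (hx : HasNoBestApprox K v x) {u u' : K → L} {e e' : ℕ}
    (h : IsMonomial v x u e) (h' : IsMonomial v x u' e') (hne : e ≠ e') :
    (IsMonomial v x (u + u') e ∨ IsMonomial v x (u + u') e') ∧
      ∀ᶠ c in approxFilter K v x, v (u c) ≤ v ((u + u') c) ∧ v (u' c) ≤ v ((u + u') c) := by
  wlog hlt : e < e' generalizing e e' u u'
  · obtain ⟨h1, h2⟩ := this h' h hne.symm (lt_of_le_of_ne (not_lt.1 hlt) hne.symm)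
    rw [add_comm u u']
    exact ⟨h1.symm, h2.mono fun c hc => hc.symm⟩
  obtain ⟨β, hβ, h⟩ := h
  obtain ⟨β', hβ', h'⟩ := h'
  rcases hx.eventually_lt_or_gt (β := β) hβ' hlt with h2 | h2
  · have key : ∀ᶠ c in approxFilter K v x, v (u c) < v (u' c) := by
      filter_upwards [h, h', h2] with c h3 h4 h5
      rwa [h3, h4]
    refine ⟨Or.inr ⟨β', hβ', ?_⟩, ?_⟩
    · filter_upwards [h', key] with c h3 h4
      rw [Pi.add_apply, v.map_add_eq_of_lt_right h4, h3]
    · filter_upwards [key] with c h4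
      rw [Pi.add_apply, v.map_add_eq_of_lt_right h4]
      exact ⟨h4.le, le_rfl⟩
  · have key : ∀ᶠ c in approxFilter K v x, v (u' c) < v (u c) := by
      filter_upwards [h, h', h2] with c h3 h4 h5
      rwa [h3, h4]
    refine ⟨Or.inl ⟨β, hβ, ?_⟩, ?_⟩
    · filter_upwards [h, key] with c h3 h4
      rw [Pi.add_apply, v.map_add_eq_of_lt_left h4, h3]
    · filter_upwards [key] with c h4
      rw [Pi.add_apply, v.map_add_eq_of_lt_left h4]
      exact ⟨le_rfl, h4.le⟩

theorem IsMonomial.sum (hx : HasNoBestApprox K v x) {s : Finset ℕ} (hs : s.Nonempty)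
    {u : ℕ → K → L} (h : ∀ i ∈ s, IsMonomial v x (u i) i) :
    (∃ i ∈ s, IsMonomial v x (∑ i ∈ s, u i) i) ∧
      ∀ᶠ c in approxFilter K v x, ∀ i ∈ s, v (u i c) ≤ v ((∑ i ∈ s, u i) c) := by
  induction hs using Finset.Nonempty.cons_induction with
  | singleton a => simpa using h
  | cons a s ha hs ih =>
    obtain ⟨⟨j, hj, h1⟩, h2⟩ := ih fun i hi => h i (Finset.mem_cons_of_mem hi)
    have hne : a ≠ j := fun h => ha (h ▸ hj)
    obtain ⟨h3, h4⟩ := (h a (Finset.mem_cons_self a s)).add hx h1 hne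
    rw [Finset.sum_cons]
    refine ⟨?_, ?_⟩
    · rcases h3 with h3 | h3
      · exact ⟨a, Finset.mem_cons_self a s, h3⟩
      · exact ⟨j, Finset.mem_cons_of_mem hj, h3⟩
    · filter_upwards [h2, h4] with c h5 h6 i hi
      rcases Finset.mem_cons.1 hi with rfl | hi
      · exact h6.1
      · exact (h5 i hi).trans h6.2

theorem IsMonomial.mul {u u' : K → L} {e e' : ℕ}
    (h : IsMonomial v x u e) (h' : IsMonomial v x u' e') :
    IsMonomial v x (u * u') (e + e') := by
  obtain ⟨β, hβ, h⟩ := h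
  obtain ⟨β', hβ', h'⟩ := h'
  refine ⟨β * β', mul_ne_zero hβ hβ', ?_⟩
  filter_upwards [h, h'] with c h1 h2
  rw [Pi.mul_apply, map_mul, h1, h2, pow_add, mul_mul_mul_comm]

theorem IsMonomial.neg {u : K → L} {e : ℕ} (h : IsMonomial v x u e) :
    IsMonomial v x (-u) e := by
  obtain ⟨β, hβ, h⟩ := h
  refine ⟨β, hβ, ?_⟩
  filter_upwards [h] with c h1
  rw [Pi.neg_apply, Valuation.map_neg, h1]

theorem isMonomial_const {z : L} (hz : z ≠ 0) : IsMonomial v x (fun _ : K => z) 0 :=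
  ⟨v z, (Valuation.ne_zero_iff v).2 hz, Eventually.of_forall fun c => by simp⟩

theorem isMonomial_sub_pow (i : ℕ) :
    IsMonomial v x (fun c : K => (x - algebraMap K L c) ^ i) i :=
  ⟨1, one_ne_zero, Eventually.of_forall fun c => by simp⟩

/-! ### Values of polynomials near `x` -/

/-- The function `K → L` given by a polynomial over `K`. -/
def polyFun (L : Type*) {K : Type*} [Field K] [Field L] [Algebra K L] (f : K[X]) : K → L :=
  fun c => algebraMap K L (f.eval c)

/-- Hasse derivatives avoid division by factorials, so the Taylor expansion is valid in every
characteristic. -/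
theorem aeval_eq_sum_hasseDeriv (f : K[X]) (x : L) (c : K) :
    aeval x f = ∑ i ∈ Finset.range (f.natDegree + 1),
      polyFun L (hasseDeriv i f) c * (x - algebraMap K L c) ^ i := by
  have h : aeval x f = aeval (x - algebraMap K L c) (taylor c f) := by
    rw [taylor_apply, aeval_comp]; simp
  rw [h, aeval_eq_sum_range, natDegree_taylor]
  simp [taylor_coeff, Algebra.smul_def, polyFun]

open Classical in
/-- The terms of the Taylor expansion with nonzero Hasse derivative. -/
theorem aeval_eq_sum_hasseDeriv_filter (f : K[X]) (x : L) (c : K) :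
    aeval x f = ∑ i ∈ (Finset.range (f.natDegree + 1)).filter (fun i => hasseDeriv i f ≠ 0),
      polyFun L (hasseDeriv i f) c * (x - algebraMap K L c) ^ i := by
  rw [aeval_eq_sum_hasseDeriv f x c]
  symm
  apply Finset.sum_filter_of_ne
  intro i _ h h0
  simp [h0, polyFun] at h

/-- If `f` has monomial values of exponent `j` and smaller polynomials have eventually constant
values, then `g` has monomial values of an exponent `i * j` with `i * f.natDegree ≤ g.natDegree`. -/
theorem exists_isMonomial_mul (hx : HasNoBestApprox K v x) {f : K[X]} {j : ℕ} (hj : 1 ≤ j)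
    (hfd : 1 ≤ f.natDegree) (hf : IsMonomial v x (polyFun L f) j)
    (hsmall : ∀ h : K[X], h ≠ 0 → h.natDegree < f.natDegree → IsMonomial v x (polyFun L h) 0)
    (g : K[X]) (hg : g ≠ 0) :
    ∃ i : ℕ, i * f.natDegree ≤ g.natDegree ∧ IsMonomial v x (polyFun L g) (i * j) := by
  induction hn : g.natDegree using Nat.strong_induction_on generalizing g with
  | _ n ih =>
    subst hn
    have hf0 : f ≠ 0 := by rintro rfl; simp at hfd
    by_cases hlt : g.natDegree < f.natDegree
    · exact ⟨0, by simp, by simpa using hsmall g hg hlt⟩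
    push Not at hlt
    have hq0 : g / f ≠ 0 := by
      rw [Ne, Polynomial.div_eq_zero_iff hf0, not_lt]
      rwa [degree_eq_natDegree hf0, degree_eq_natDegree hg, Nat.cast_le]
    have hdeg : (g / f).natDegree = g.natDegree - f.natDegree := by
      have h1 := degree_add_div hf0 (p := g)
        (by rwa [degree_eq_natDegree hf0, degree_eq_natDegree hg, Nat.cast_le])
      rw [degree_eq_natDegree hf0, degree_eq_natDegree hg, degree_eq_natDegree hq0] at h1
      have h2 : f.natDegree + (g / f).natDegree = g.natDegree := by exact_mod_cast h1
      omega
    obtain ⟨i, hi, hm⟩ := ih (g / f).natDegree (by omega) (g / f) hq0 rfl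
    have hle : (i + 1) * f.natDegree ≤ g.natDegree := by
      rw [add_mul, one_mul]; omega
    have hm' : IsMonomial v x (polyFun L (f * (g / f))) ((i + 1) * j) := by
      have := hf.mul hm
      have e : polyFun L (f * (g / f)) = polyFun L f * polyFun L (g / f) := by
        ext c; simp [polyFun]
      rw [e]
      convert this using 1
      ring
    have hdec : polyFun L g = polyFun L (f * (g / f)) + polyFun L (g % f) := by
      ext c
      simp only [polyFun, Pi.add_apply, ← map_add, ← eval_add, EuclideanDomain.div_add_mod]
    by_cases hr : g % f = 0
    · refine ⟨i + 1, hle, ?_⟩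
      rw [hdec, hr]
      convert hm' using 1
      ext c; simp [polyFun]
    · have hrm := hsmall (g % f) hr (natDegree_mod_lt g (by omega))
      -- Since `j ≥ 1`, the exponent `(i + 1) * j` of the multiple of `f` is not the exponent `0` of
      -- the remainder. If the remainder dominates, the exponent is `0 * j`.
      rcases (hm'.add hx hrm (by positivity)).1 with h | h
      · exact ⟨i + 1, hle, hdec ▸ h⟩
      · exact ⟨0, by simp, by simpa using hdec ▸ h⟩

/-- If the minimal polynomial of `x` has prime degree `p` and values `v (x - c) ^ p`, then
polynomials of degree less than `p` have eventually constant values. -/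
theorem isMonomial_zero_of_natDegree_lt (hx : HasNoBestApprox K v x) {g : K[X]}
    (hprime : g.natDegree.Prime) (hirr : ∀ f : K[X], f ≠ 0 → aeval x f = 0 →
      g.natDegree ≤ f.natDegree) (hg : IsMonomial v x (polyFun L g) g.natDegree)
    (f : K[X]) (hf : f ≠ 0) (hlt : f.natDegree < g.natDegree) :
    IsMonomial v x (polyFun L f) 0 := by
  induction hn : f.natDegree using Nat.strong_induction_on generalizing f with
  | _ n ih =>
    subst hn
    classical
    have hfx : aeval x f ≠ 0 := fun h => (hirr f hf h).not_gt hlt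
    rcases Nat.eq_zero_or_pos f.natDegree with h0 | hpos
    · rw [natDegree_eq_zero] at h0
      obtain ⟨a, rfl⟩ := h0
      have ha : algebraMap K L a ≠ 0 := by
        simpa using hf
      have e : polyFun L (C a) = fun _ : K => algebraMap K L a := by ext c; simp [polyFun]
      exact e ▸ isMonomial_const ha
    have hsmall : ∀ h : K[X], h ≠ 0 → h.natDegree < f.natDegree →
        IsMonomial v x (polyFun L h) 0 := fun h h1 h2 => ih _ h2 h h1 (h2.trans hlt) rfl
    -- the exponent of `f`
    obtain ⟨j, hjd, hj⟩ : ∃ j ≤ f.natDegree, IsMonomial v x (polyFun L f) j := by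
      -- Solve the Taylor expansion for `f c`: it is the constant `f x` minus the terms of index `i
      -- ≥ 1`. Their Hasse derivatives have smaller degree, hence exponent `0`, so the summand of
      -- index `i` has exponent exactly `i`.
      let s := (Finset.range (f.natDegree + 1)).filter (fun i => i = 0 ∨ hasseDeriv i f ≠ 0)
      let u : ℕ → K → L := fun i => if i = 0 then fun _ => aeval x f else
        -(polyFun L (hasseDeriv i f) * fun c => (x - algebraMap K L c) ^ i)
      have hs : s.Nonempty := ⟨0, by simp [s]⟩
      have hu : ∀ i ∈ s, IsMonomial v x (u i) i := by
        intro i hi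
        by_cases h0 : i = 0
        · subst h0
          simpa [u] using isMonomial_const (K := K) (v := v) (x := x) hfx
        · have h1 : hasseDeriv i f ≠ 0 := by
            simpa [s, h0] using (Finset.mem_filter.1 hi).2
          simp only [u, h0, if_false]
          have h2 := hsmall _ h1 (lt_of_le_of_lt (natDegree_hasseDeriv_le f i) (by omega))
          simpa using (h2.mul (isMonomial_sub_pow i)).neg
      obtain ⟨⟨j, hj, h⟩, -⟩ := IsMonomial.sum hx hs hu
      refine ⟨j, Nat.lt_succ_iff.1 (Finset.mem_range.1 (Finset.mem_filter.1 hj).1), ?_⟩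
      convert h using 1
      ext c
      have e1 := aeval_eq_sum_hasseDeriv f x c
      have e2 : (∑ i ∈ s, u i) c = ∑ i ∈ Finset.range (f.natDegree + 1), u i c := by
        rw [Finset.sum_apply]
        apply Finset.sum_filter_of_ne
        intro i _ h
        by_contra! h'
        simp [u, h'.1, h'.2, polyFun] at h
      rw [e2, Finset.sum_range_succ']
      rw [Finset.sum_range_succ'] at e1
      simp [u] at e1 ⊢
      rw [e1]
      simp [polyFun]
    rcases Nat.eq_zero_or_pos j with rfl | hjpos
    · exact hj
    exfalso
    obtain ⟨i, hi, hm⟩ := exists_isMonomial_mul hx hjpos hpos hj hsmall g (by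
      rintro rfl; simp at hlt)
    have he := hm.exponent_unique hx hg
    have hfg : f.natDegree ∣ g.natDegree := by
      -- The chain `g.natDegree = i * j ≤ i * f.natDegree ≤ g.natDegree` collapses to equalities.
      have h1 : i * j ≤ i * f.natDegree := Nat.mul_le_mul_left i hjd
      exact ⟨i, by rw [mul_comm]; omega⟩
    rcases (Nat.dvd_prime hprime).1 hfg with h1 | h1
    · -- a linear polynomial
      obtain ⟨a, ha, b, rfl⟩ := natDegree_eq_one.1 h1
      have hab : ∀ y : L, algebraMap K L a * y + algebraMap K L b =
          algebraMap K L a * (y - algebraMap K L (-b / a)) := by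
        intro y
        have : algebraMap K L a ≠ 0 := by simpa using ha
        simp only [map_div₀, map_neg]
        field_simp
        ring
      -- Once `c` is closer to `x` than the root `-b / a` is, the value at `c` equals the value at
      -- `x`, contradicting `j ≥ 1`.
      have hj1 : IsMonomial v x (polyFun L (C a * X + C b)) 0 := by
        refine ⟨v (algebraMap K L a * (x - algebraMap K L (-b / a))), ?_, ?_⟩
        · rw [← hab]
          simpa using hfx
        · filter_upwards [hx.eventually_lt (-b / a)] with c hc
          have e : polyFun L (C a * X + C b) c = algebraMap K L a *
              (-(x - algebraMap K L c) + (x - algebraMap K L (-b / a))) := by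
            simp only [polyFun, eval_add, eval_mul, eval_C, eval_X, map_add, map_mul]
            rw [hab]; ring
          rw [e, map_mul, v.map_add_eq_of_lt_right (by rwa [Valuation.map_neg]), map_mul]
          simp
      have := hj.exponent_unique hx hj1
      omega
    · omega

/-- Eventually, the terms of the Taylor expansion do not exceed the value of the polynomial. -/
theorem eventually_forall_term_le (hx : HasNoBestApprox K v x) {g : K[X]}
    (hprime : g.natDegree.Prime) (hirr : ∀ f : K[X], f ≠ 0 → aeval x f = 0 →
      g.natDegree ≤ f.natDegree) (hg : IsMonomial v x (polyFun L g) g.natDegree)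
    (f : K[X]) (hlt : f.natDegree < g.natDegree) :
    ∀ᶠ c in approxFilter K v x, ∀ i : ℕ,
      v (polyFun L (hasseDeriv i f) c * (x - algebraMap K L c) ^ i) ≤ v (aeval x f) := by
  by_cases hf : f = 0
  · subst hf
    simp [polyFun]
  classical
  let s := (Finset.range (f.natDegree + 1)).filter (fun i => hasseDeriv i f ≠ 0)
  let u : ℕ → K → L := fun i =>
    polyFun L (hasseDeriv i f) * fun c => (x - algebraMap K L c) ^ i
  have hs : s.Nonempty := ⟨0, by simp [s, hf]⟩
  have hu : ∀ i ∈ s, IsMonomial v x (u i) i := by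
    intro i hi
    have h2 := isMonomial_zero_of_natDegree_lt hx hprime hirr hg (hasseDeriv i f)
      (Finset.mem_filter.1 hi).2 (lt_of_le_of_lt (natDegree_hasseDeriv_le f i) (by omega))
    simpa [u] using h2.mul (isMonomial_sub_pow i)
  filter_upwards [(IsMonomial.sum hx hs hu).2] with c hc i
  by_cases h0 : hasseDeriv i f = 0
  · simp [h0, polyFun]
  · have hi : i ∈ s := by
      refine Finset.mem_filter.2 ⟨Finset.mem_range.2 ?_, h0⟩
      by_contra! h
      exact h0 (hasseDeriv_eq_zero_of_lt_natDegree f i (by omega))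
    rw [aeval_eq_sum_hasseDeriv_filter f x c]
    simpa [u] using hc i hi

end Approximation

/-! ### Immediacy and invariance of the valuation -/

section Immediate

variable {K L Γ₀ : Type*} [Field K] [Field L] [Algebra K L]
  [LinearOrderedCommGroupWithZero Γ₀] {v : Valuation L Γ₀}

/-- In a factorization of a prime, the factor `q ^ ν > 1` leaves `1` for the product of index and
degree. The convention `0` for infinite quantities cannot intervene. -/
theorem IsDefectExtension.index_eq_one (hdef : IsDefectExtension K v)
    (hp : (Module.finrank K L).Prime) : ramificationIndex K v = 1 ∧ residueDegree K v = 1 := by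
  obtain ⟨-, -, ν, h1, h2⟩ := hdef
  rw [h1] at hp
  have := (Nat.prime_mul_iff.1 hp)
  rcases this with ⟨-, h⟩ | ⟨-, h⟩
  · exact mul_eq_one.1 h
  · omega

theorem exists_value_eq (h : ramificationIndex K v = 1) {x : L} (hx : x ≠ 0) :
    ∃ a : K, a ≠ 0 ∧ v x = v (algebraMap K L a) := by
  have hle := Subgroup.relIndex_eq_one.1 h
  have hvx : v x ≠ 0 := (Valuation.ne_zero_iff v).2 hx
  have h1 : Units.mk0 (v x) hvx ∈
      MonoidWithZeroHom.valueGroup (restrictVal K v).toMonoidWithZeroHom :=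
    hle (MonoidWithZeroHom.mem_valueGroup _ ⟨x, rfl⟩)
  rw [MonoidWithZeroHom.mem_valueGroup_iff_of_comm] at h1
  obtain ⟨a, ha, b, hb⟩ := h1
  change v (algebraMap K L a) ≠ 0 at ha
  change v (algebraMap K L a) * v x = v (algebraMap K L b) at hb
  refine ⟨b / a, ?_, ?_⟩
  · rintro h0
    have hb0 : v (algebraMap K L b) ≠ 0 := hb ▸ mul_ne_zero ha hvx
    have ha0 : a ≠ 0 := by rintro rfl; simp at ha
    have : b ≠ 0 := by rintro rfl; simp at hb0
    exact div_ne_zero this ha0 h0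
  · rw [map_div₀, map_div₀, ← hb, mul_div_cancel_left₀ _ ha]

theorem exists_sub_lt_one (h : residueDegree K v = 1) {u : L} (hu : v u ≤ 1) :
    ∃ b : K, v (u - algebraMap K L b) < 1 := by
  let R := IsLocalRing.ResidueField (restrictVal K v).valuationSubring
  let y : v.valuationSubring := ⟨u, hu⟩
  obtain ⟨c, hc⟩ := (finrank_eq_one_iff_of_nonzero' (K := R)
    (1 : IsLocalRing.ResidueField v.valuationSubring) one_ne_zero).1 h (IsLocalRing.residue _ y)
  obtain ⟨b, rfl⟩ := IsLocalRing.residue_surjective c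
  refine ⟨b, ?_⟩
  rw [Algebra.smul_def, mul_one] at hc
  change IsLocalRing.residue _ (algebraMap _ v.valuationSubring b) = _ at hc
  have h1 : IsLocalRing.residue _ (y - algebraMap _ v.valuationSubring b) = 0 := by
    rw [map_sub, hc, sub_self]
  rw [IsLocalRing.residue_eq_zero_iff] at h1
  exact v.isEquiv_valuation_valuationSubring.lt_one_iff_lt_one.2
    ((ValuationSubring.valuation_lt_one_iff _ _).1 h1)

/-- Equal value groups allow scaling `x - c` to a unit by some `a` in `K`; equal residue fields give
`b` in `K` with the same residue. Then `c + a * b` is strictly closer. -/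
theorem hasNoBestApprox (he : ramificationIndex K v = 1) (hf : residueDegree K v = 1) {x : L}
    (hx : ∀ c : K, x ≠ algebraMap K L c) : HasNoBestApprox K v x := by
  intro c
  obtain ⟨a, ha, hva⟩ := exists_value_eq he (sub_ne_zero.2 (hx c))
  have ha' : algebraMap K L a ≠ 0 := by simpa using ha
  have hva' : v (algebraMap K L a) ≠ 0 := (Valuation.ne_zero_iff v).2 ha'
  obtain ⟨b, hb⟩ := exists_sub_lt_one hf (u := (x - algebraMap K L c) / algebraMap K L a)
    (by rw [map_div₀, hva, div_self hva'])
  refine ⟨c + a * b, ?_⟩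
  have e : x - algebraMap K L (c + a * b) =
      algebraMap K L a * ((x - algebraMap K L c) / algebraMap K L a - algebraMap K L b) := by
    simp only [map_add, map_mul]
    field_simp
    ring
  rw [e, map_mul, hva]
  exact mul_lt_of_lt_one_right (zero_lt_iff.2 hva') hb

theorem IsUnibranched.map_algEquiv (hu : IsUnibranched K v) (he : ramificationIndex K v = 1)
    (σ : L ≃ₐ[K] L) (x : L) : v (σ x) = v x := by
  have hA : v.valuationSubring.comap (σ : L →+* L) = v.valuationSubring := by
    apply hu
    ext a
    simp [ValuationSubring.mem_comap]
  have hle : ∀ y : L, v (σ y) ≤ 1 ↔ v y ≤ 1 := fun y => by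
    have := SetLike.ext_iff.1 hA y
    simpa [ValuationSubring.mem_comap] using this
  by_cases hx : x = 0
  · simp [hx]
  -- Equality of the valuation rings gives only equivalence of valuations. Comparing with an element
  -- of `K` of the same value, which `σ` fixes, gives equality of values.
  obtain ⟨a, ha, hva⟩ := exists_value_eq he hx
  have ha' : algebraMap K L a ≠ 0 := by simpa using ha
  have hva' : v (algebraMap K L a) ≠ 0 := (Valuation.ne_zero_iff v).2 ha'
  have hσx : v (σ x) ≠ 0 := (Valuation.ne_zero_iff v).2 (by simpa using hx)
  apply le_antisymm
  · have h1 := (hle (x / algebraMap K L a)).2 (by rw [map_div₀, hva, div_self hva'])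
    rw [map_div₀, map_div₀, AlgEquiv.commutes, ← hva] at h1
    rwa [div_le_one₀ (zero_lt_iff.2 (hva ▸ hva'))] at h1
  · have h1 := (hle (algebraMap K L a / x)).2 (by rw [map_div₀, hva, div_self hva'])
    rw [map_div₀, map_div₀, AlgEquiv.commutes, ← hva] at h1
    rwa [div_le_one₀ (zero_lt_iff.2 hσx)] at h1

end Immediate

/-! ### Conjugates, minimal polynomials and integrality -/

section Galois

variable {K L Γ₀ : Type*} [Field K] [Field L] [Algebra K L] [FiniteDimensional K L]
  [IsGalois K L] [LinearOrderedCommGroupWithZero Γ₀] {v : Valuation L Γ₀}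

theorem minpoly_map_eq_prod (x : L) : (minpoly K x).map (algebraMap K L) =
    (((minpoly K x).map (algebraMap K L)).roots.map fun a => X - C a).prod :=
  (IsGalois.splits K x).eq_prod_roots_of_monic ((minpoly.monic (IsIntegral.of_finite K x)).map _)

theorem value_root_sub {K L Γ₀ : Type*} [Field K] [Field L] [Algebra K L] [IsGalois K L]
    [LinearOrderedCommGroupWithZero Γ₀] {v : Valuation L Γ₀}
    (hv : ∀ (σ : L ≃ₐ[K] L) (y : L), v (σ y) = v y) {x a : L}
    (ha : a ∈ ((minpoly K x).map (algebraMap K L)).roots) (c : K) :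
    v (a - algebraMap K L c) = v (x - algebraMap K L c) := by
  have h1 : aeval a (minpoly K x) = 0 := by
    have := isRoot_of_mem_roots ha
    rwa [IsRoot, eval_map_algebraMap] at this
  obtain ⟨σ, rfl⟩ := minpoly.exists_algEquiv_of_root' (Algebra.IsAlgebraic.isAlgebraic x) h1
  rw [← hv σ (x - algebraMap K L c), map_sub σ, AlgEquiv.commutes]

/-- The minimal polynomial splits over `L`, and all conjugates of `x` are equally far from `c`. -/
theorem value_minpoly_eval (hv : ∀ (σ : L ≃ₐ[K] L) (y : L), v (σ y) = v y) (x : L) (c : K) :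
    v (algebraMap K L ((minpoly K x).eval c)) =
      v (x - algebraMap K L c) ^ (minpoly K x).natDegree := by
  have h1 : algebraMap K L ((minpoly K x).eval c) =
      ((minpoly K x).map (algebraMap K L)).eval (algebraMap K L c) := by
    rw [eval_map_algebraMap, aeval_algebraMap_apply, coe_aeval_eq_eval]
  have hcard : (minpoly K x).natDegree =
      ((minpoly K x).map (algebraMap K L)).roots.card := by
    rw [← (IsGalois.splits K x).natDegree_eq_card_roots, natDegree_map]
  rw [h1, minpoly_map_eq_prod, eval_multiset_prod, map_multiset_prod, Multiset.map_map,
    Multiset.map_map, hcard, ← Multiset.prod_replicate]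
  congr 1
  rw [Multiset.eq_replicate]
  refine ⟨by simp, fun b hb => ?_⟩
  obtain ⟨a, ha, rfl⟩ := Multiset.mem_map.1 hb
  simp only [Function.comp_apply, eval_sub, eval_X, eval_C]
  rw [Valuation.map_sub_swap, value_root_sub hv ha c]

/-- All conjugates of `x` are integral for `v`, so the coefficients of its minimal polynomial lie in
`𝒪_L ∩ K = 𝒪_K`. -/
theorem isIntegral_of_value_le_one (hv : ∀ (σ : L ≃ₐ[K] L) (y : L), v (σ y) = v y) {x : L}
    (hx : v x ≤ 1) : IsIntegral (restrictVal K v).valuationSubring x := by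
  have h1 : (minpoly K x).map (algebraMap K L) ∈ lifts v.valuationSubring.subtype := by
    rw [minpoly_map_eq_prod]
    apply Subsemiring.multiset_prod_mem
    intro q hq
    obtain ⟨a, ha, rfl⟩ := Multiset.mem_map.1 hq
    have h2 : v a ≤ 1 := by simpa using (value_root_sub hv ha 0).le.trans (by simpa using hx)
    exact (mem_lifts _).2 ⟨X - C ⟨a, h2⟩, by simp⟩
  have h2 : minpoly K x ∈ lifts (algebraMap (restrictVal K v).valuationSubring K) := by
    rw [lifts_iff_coeff_lifts] at h1 ⊢
    intro n
    obtain ⟨y, hy⟩ := h1 n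
    rw [coeff_map] at hy
    exact ⟨⟨(minpoly K x).coeff n, by
      change v (algebraMap K L _) ≤ 1
      rw [← hy]; exact y.2⟩, rfl⟩
  obtain ⟨q, hq, -, hmon⟩ :=
    lifts_and_natDegree_eq_and_monic h2 (minpoly.monic (IsIntegral.of_finite K x))
  refine ⟨q, hmon, ?_⟩
  have h3 : aeval x (q.map (algebraMap (restrictVal K v).valuationSubring K)) = 0 := by
    rw [hq, minpoly.aeval]
  rwa [aeval_map_algebraMap] at h3

end Galois

/-! ### Rings generated by normalized elements -/

section NormRing

variable {K L Γ₀ : Type*} [Field K] [Field L] [Algebra K L]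
  [LinearOrderedCommGroupWithZero Γ₀] {v : Valuation L Γ₀} {t : Γ₀ → K}

theorem algebraMap_mem_ringAdjoin (x : L) {a : K} (ha : v (algebraMap K L a) ≤ 1) :
    algebraMap K L a ∈ ringAdjoin K v x :=
  (Algebra.adjoin (restrictVal K v).valuationSubring {x}).algebraMap_mem ⟨a, ha⟩

theorem self_mem_ringAdjoin (x : L) : x ∈ ringAdjoin K v x :=
  Algebra.self_mem_adjoin_singleton _ x

theorem ringAdjoin_le {x : L} {S : Subring L}
    (hS : ∀ a : K, v (algebraMap K L a) ≤ 1 → algebraMap K L a ∈ S) (hx : x ∈ S) :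
    ringAdjoin K v x ≤ S := by
  intro y hy
  change y ∈ Algebra.adjoin (restrictVal K v).valuationSubring {x} at hy
  induction hy using Algebra.adjoin_induction with
  | mem z hz => rwa [Set.mem_singleton_iff.1 hz]
  | algebraMap a => exact hS a a.2
  | add _ _ _ _ h1 h2 => exact S.add_mem h1 h2
  | mul _ _ _ _ h1 h2 => exact S.mul_mem h1 h2

/-- The section is controlled only on values from `K`; `vL = vK` extends its use to elements of `L`.
-/
theorem IsValueSection.mul_value (ht : IsValueSection K v t) (he : ramificationIndex K v = 1)
    {y : L} (hy : y ≠ 0) : v (algebraMap K L (t (v y))) * v y = 1 := by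
  obtain ⟨a, ha, hva⟩ := exists_value_eq he hy
  have h1 := ht a ha
  change v (algebraMap K L (t (v (algebraMap K L a)))) = (v (algebraMap K L a))⁻¹ at h1
  rw [hva, h1]
  exact inv_mul_cancel₀ (hva ▸ (Valuation.ne_zero_iff v).2 hy)

theorem normRing_le_valuationSubring (ht : IsValueSection K v t)
    (he : ramificationIndex K v = 1) {y : L} (hy : y ≠ 0) :
    normRing K v t y ≤ v.valuationSubring.toSubring := by
  refine ringAdjoin_le (fun a ha => ha) ?_
  change v _ ≤ 1
  rw [map_mul, ht.mul_value he hy]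

/-- Normalizing turns the relation into one with coefficients `t₁ * k / t₂` and `t₁ * b`, where `tᵢ
= t (v yᵢ)`. Both are integral because neither `k * y₂` nor `b` exceeds `y₁` in value. -/
theorem normRing_le_normRing (ht : IsValueSection K v t) (he : ramificationIndex K v = 1)
    {y₁ y₂ : L} (hy₁ : y₁ ≠ 0) (hy₂ : y₂ ≠ 0) {k b : K}
    (h : y₁ = algebraMap K L k * y₂ + algebraMap K L b)
    (hle : v (algebraMap K L k * y₂) ≤ v y₁) : normRing K v t y₁ ≤ normRing K v t y₂ := by
  have h1 := ht.mul_value he hy₁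
  have h2 := ht.mul_value he hy₂
  have ht2 : t (v y₂) ≠ 0 := by
    intro h0
    simp [h0] at h2
  have ht2' : algebraMap K L (t (v y₂)) ≠ 0 := by simpa using ht2
  have hvt2 : v (algebraMap K L (t (v y₂))) ≠ 0 := (Valuation.ne_zero_iff v).2 ht2'
  refine ringAdjoin_le (fun a ha => algebraMap_mem_ringAdjoin _ ha) ?_
  have e : algebraMap K L (t (v y₁)) * y₁ =
      algebraMap K L (t (v y₁) * k / t (v y₂)) * (algebraMap K L (t (v y₂)) * y₂) +
        algebraMap K L (t (v y₁) * b) := by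
    nth_rw 2 [h]
    simp only [map_mul, map_div₀]
    field_simp
  rw [e]
  refine Subring.add_mem _ (Subring.mul_mem _ (algebraMap_mem_ringAdjoin _ ?_)
    (self_mem_ringAdjoin _)) (algebraMap_mem_ringAdjoin _ ?_)
  · have h3 : v (algebraMap K L (t (v y₁) * k / t (v y₂))) =
        v (algebraMap K L (t (v y₁))) * v (algebraMap K L k * y₂) := by
      rw [map_div₀, map_div₀, map_mul, map_mul, map_mul, ← mul_assoc, div_eq_iff hvt2, mul_assoc,
        mul_comm (v y₂), h2, mul_one]
    rw [h3, ← h1]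
    gcongr
  · have hb : algebraMap K L b = y₁ - algebraMap K L k * y₂ := by rw [h]; ring
    rw [map_mul, map_mul, hb, ← h1]
    gcongr
    exact (v.map_sub _ _).trans (max_le le_rfl hle)

/-- With `w` the normalized `y₂`, the normalized `y₁` is linear in `w` with leading coefficient `t
(v y₁) / t (v y₂)`, of value `v y₂ / v y₁ > 1`. Below the degree of the minimal polynomial of `w`,
which is at least `2`, polynomial representations are unique, so an integral one would force this
coefficient into `𝒪_K`. -/
theorem not_normRing_le_normRing [FiniteDimensional K L] [IsGalois K L]
    (hv : ∀ (σ : L ≃ₐ[K] L) (y : L), v (σ y) = v y)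
    (ht : IsValueSection K v t) (he : ramificationIndex K v = 1)
    {y₁ y₂ : L} (hy₁ : y₁ ≠ 0) (hy₂ : ∀ c : K, y₂ ≠ algebraMap K L c) {b : K}
    (h : y₁ = y₂ + algebraMap K L b) (hlt : v y₁ < v y₂) :
    ¬ normRing K v t y₁ ≤ normRing K v t y₂ := by
  intro hle
  have hy₂0 : y₂ ≠ 0 := by simpa using hy₂ 0
  have h1 := ht.mul_value he hy₁
  have h2 := ht.mul_value he hy₂0
  have ht2 : t (v y₂) ≠ 0 := by
    intro h0
    simp [h0] at h2
  have ht2' : algebraMap K L (t (v y₂)) ≠ 0 := by simpa using ht2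
  have hvt2 : v (algebraMap K L (t (v y₂))) ≠ 0 := (Valuation.ne_zero_iff v).2 ht2'
  have hmem : algebraMap K L (t (v y₁)) * y₁ ∈ normRing K v t y₂ :=
    hle (self_mem_ringAdjoin _)
  obtain ⟨w, hw⟩ : ∃ w, w = algebraMap K L (t (v y₂)) * y₂ := ⟨_, rfl⟩
  change _ ∈ Algebra.adjoin (restrictVal K v).valuationSubring {_} at hmem
  rw [← hw, Algebra.adjoin_singleton_eq_range_aeval] at hmem
  obtain ⟨q, hq⟩ := hmem
  have hint : IsIntegral (restrictVal K v).valuationSubring w :=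
    isIntegral_of_value_le_one hv (by rw [hw, map_mul, h2])
  -- As `𝒪_K` is integrally closed, the minimal polynomial of `w` is already defined over it, so
  -- reduction modulo it keeps coefficients integral.
  have hmin := minpoly.isIntegrallyClosed_eq_field_fractions' K hint
  have hmonic := minpoly.monic hint
  have hdeg : 2 ≤ (minpoly K w).natDegree := by
    rw [minpoly.two_le_natDegree_iff (IsIntegral.of_finite K w)]
    rintro ⟨c, hc⟩
    apply hy₂ (c / t (v y₂))
    change algebraMap K L c = w at hc
    rw [map_div₀, hc, hw, mul_div_cancel_left₀ _ ht2']
  obtain ⟨r, hr⟩ : ∃ r, r = q %ₘ minpoly (restrictVal K v).valuationSubring w := ⟨_, rfl⟩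
  have hrw : aeval w r = algebraMap K L (t (v y₁)) * y₁ := by
    rw [hr, ← hq, aeval_modByMonic_eq_self_of_root (minpoly.aeval _ _)]
    rfl
  have hrdeg : (r.map (algebraMap (restrictVal K v).valuationSubring K)).degree <
      (minpoly K w).degree := by
    rw [hmin, hmonic.degree_map]
    exact lt_of_le_of_lt degree_map_le (hr ▸ degree_modByMonic_lt _ hmonic)
  have hlin : (C (t (v y₁) / t (v y₂)) * X + C (t (v y₁) * b)).degree <
      (minpoly K w).degree := by
    refine lt_of_le_of_lt degree_linear_le ?_
    rw [degree_eq_natDegree (minpoly.ne_zero (IsIntegral.of_finite K w))]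
    exact_mod_cast hdeg
  have hzero : r.map (algebraMap (restrictVal K v).valuationSubring K) -
      (C (t (v y₁) / t (v y₂)) * X + C (t (v y₁) * b)) = 0 := by
    by_contra hne
    have := minpoly.degree_le_of_ne_zero K w hne (by
      rw [map_sub, aeval_map_algebraMap, hrw, h, hw]
      simp only [map_add, map_mul, aeval_C, aeval_X, map_div₀]
      field_simp
      ring)
    exact absurd ((degree_sub_le _ _).trans_lt (max_lt hrdeg hlin)) this.not_gt
  have hcoeff := congrArg (fun f => coeff f 1) (sub_eq_zero.1 hzero)
  simp only [coeff_map, coeff_add, coeff_C_mul, coeff_X_one, mul_one, coeff_C_succ,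
    add_zero] at hcoeff
  have hval : v (algebraMap K L (t (v y₁) / t (v y₂))) ≤ 1 := by
    rw [← hcoeff]
    exact (r.coeff 1).2
  rw [map_div₀, map_div₀, div_le_one₀ (zero_lt_iff.2 hvt2)] at hval
  have hpos : 0 < v (algebraMap K L (t (v y₁))) := by
    rw [zero_lt_iff]
    intro h0
    simp [h0] at h1
  have h5 := mul_lt_mul_of_pos_left hlt hpos
  rw [h1] at h5
  exact absurd (h2 ▸ h5.trans_le (mul_le_mul_left hval _)) (lt_irrefl _)

theorem eventually_mem_normRing {x z : L} (hx : HasNoBestApprox K v x)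
    (ht : IsValueSection K v t) (he : ramificationIndex K v = 1) {g : K[X]}
    (hprime : g.natDegree.Prime) (hirr : ∀ f : K[X], f ≠ 0 → aeval x f = 0 →
      g.natDegree ≤ f.natDegree) (hg : IsMonomial v x (polyFun L g) g.natDegree)
    (hz : ∃ f : K[X], f.natDegree < g.natDegree ∧ aeval x f = z) (hvz : v z ≤ 1) :
    ∀ᶠ c in approxFilter K v x, z ∈ normRing K v t (x - algebraMap K L c) := by
  obtain ⟨f, hf, rfl⟩ := hz
  filter_upwards [eventually_forall_term_le hx hprime hirr hg f hf] with c hc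
  have hy : x - algebraMap K L c ≠ 0 := (Valuation.ne_zero_iff v).1 (hx.sub_pos c).ne'
  have h1 := ht.mul_value he hy
  rw [aeval_eq_sum_hasseDeriv f x c]
  refine Subring.sum_mem _ fun i _ => ?_
  have ht0 : t (v (x - algebraMap K L c)) ≠ 0 := by
    intro h0
    simp [h0] at h1
  have ht0' : algebraMap K L (t (v (x - algebraMap K L c))) ≠ 0 := by simpa using ht0
  have e : polyFun L (hasseDeriv i f) c * (x - algebraMap K L c) ^ i =
      algebraMap K L ((hasseDeriv i f).eval c / t (v (x - algebraMap K L c)) ^ i) *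
        (algebraMap K L (t (v (x - algebraMap K L c))) * (x - algebraMap K L c)) ^ i := by
    rw [polyFun, mul_pow, map_div₀, map_pow]
    field_simp
  rw [e]
  refine Subring.mul_mem _ (algebraMap_mem_ringAdjoin _ ?_)
    (Subring.pow_mem _ (self_mem_ringAdjoin _) i)
  -- The normalized `x - c` has value `1`, so the coefficient has the value of the whole Taylor
  -- term, which is at most `v z ≤ 1`.
  have h2 := (hc i).trans hvz
  rw [e, map_mul, map_pow, map_mul, h1, one_pow, mul_one] at h2
  exact h2

end NormRing

/-! ### Generators of simple extensions -/

section Generators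

theorem exists_zmod_of_pow_eq_self {p : ℕ} [Fact p.Prime] {F : Type*} [Field F] [CharP F p]
    {d : F} (hd : d ^ p = d) : ∃ k : ZMod p, ZMod.castHom dvd_rfl F k = d := by
  rw [← Subfield.mem_bot_iff_pow_eq_self F p, ← ZMod.fieldRange_castHom_eq_bot p] at hd
  exact hd

variable {K L : Type*} [Field K] [Field L] [Algebra K L]

theorem adjoin_sub_algebraMap_eq_top {x : L} (hx : K⟮x⟯ = ⊤) (c : K) :
    K⟮x - algebraMap K L c⟯ = ⊤ := by
  rw [eq_top_iff, ← hx, IntermediateField.adjoin_simple_le_iff]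
  have h := IntermediateField.mem_adjoin_simple_self K (x - algebraMap K L c)
  simpa using add_mem h (IntermediateField.algebraMap_mem _ c)

variable [FiniteDimensional K L]

theorem natDegree_minpoly_of_adjoin_eq_top {x : L} (hx : K⟮x⟯ = ⊤) :
    (minpoly K x).natDegree = Module.finrank K L := by
  rw [← IntermediateField.adjoin.finrank (IsIntegral.of_finite K x), hx,
    IntermediateField.finrank_top']

theorem ne_algebraMap_of_adjoin_eq_top (hp : (Module.finrank K L).Prime) {x : L}
    (hx : K⟮x⟯ = ⊤) (c : K) : x ≠ algebraMap K L c := by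
  rintro rfl
  have h := natDegree_minpoly_of_adjoin_eq_top hx
  rw [minpoly.eq_X_sub_C, natDegree_X_sub_C] at h
  exact hp.one_lt.ne h

theorem exists_aeval_eq_of_adjoin_eq_top {x : L} (hx : K⟮x⟯ = ⊤) (z : L) :
    ∃ f : K[X], f.natDegree < (minpoly K x).natDegree ∧ aeval x f = z := by
  have hint := IsIntegral.of_finite K x
  have hz : z ∈ K⟮x⟯.toSubalgebra := by rw [hx]; trivial
  rw [IntermediateField.adjoin_simple_toSubalgebra_of_isAlgebraic hint.isAlgebraic,
    Algebra.adjoin_singleton_eq_range_aeval] at hz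
  obtain ⟨q, hq⟩ := hz
  refine ⟨q %ₘ minpoly K x, natDegree_modByMonic_lt _ (minpoly.monic hint)
    (minpoly.ne_one K x), ?_⟩
  rw [aeval_modByMonic_eq_self_of_root (minpoly.aeval _ _)]
  exact hq

theorem normRing_le_of_adjoin_eq_top {Γ₀ : Type*}
    [LinearOrderedCommGroupWithZero Γ₀] {v : Valuation L Γ₀} {t : Γ₀ → K}
    (hdef : IsDefectExtension K v) (hp : (Module.finrank K L).Prime) (ht : IsValueSection K v t) {x : L} (hx : K⟮x⟯ = ⊤) :
    normRing K v t x ≤ v.valuationSubring.toSubring :=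
  normRing_le_valuationSubring ht (hdef.index_eq_one hp).1
    (by simpa using ne_algebraMap_of_adjoin_eq_top hp hx 0)

end Generators

/-! ### Translates of a generator in prime degree; Artin-Schreier generators -/

section PrimeDegree

variable {K L Γ₀ : Type*} [Field K] [Field L] [Algebra K L] [FiniteDimensional K L]
  [IsGalois K L] [LinearOrderedCommGroupWithZero Γ₀] {v : Valuation L Γ₀} {t : Γ₀ → K}

theorem normRing_sub_le_iff (hdef : IsDefectExtension K v) (hp : (Module.finrank K L).Prime)
    (ht : IsValueSection K v t) {x : L} (hx : K⟮x⟯ = ⊤) (c₁ c₂ : K) :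
    normRing K v t (x - algebraMap K L c₁) ≤ normRing K v t (x - algebraMap K L c₂) ↔
      v (x - algebraMap K L c₂) ≤ v (x - algebraMap K L c₁) := by
  obtain ⟨he, hf⟩ := hdef.index_eq_one hp
  have hne := ne_algebraMap_of_adjoin_eq_top hp hx
  constructor
  · intro h
    by_contra! hlt
    refine not_normRing_le_normRing (hdef.2.1.map_algEquiv he) ht he (sub_ne_zero.2 (hne c₁))
      (fun c hc => hne (c + c₂) ?_) (b := c₂ - c₁) ?_ hlt h
    · rw [map_add, ← hc, sub_add_cancel]
    · rw [map_sub]; ring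
  · intro h
    refine normRing_le_normRing ht he (sub_ne_zero.2 (hne c₁)) (sub_ne_zero.2 (hne c₂))
      (k := 1) (b := c₂ - c₁) ?_ (by simpa using h)
    rw [map_sub, map_one]; ring

theorem normRing_sub_lt_iff (hdef : IsDefectExtension K v) (hp : (Module.finrank K L).Prime)
    (ht : IsValueSection K v t) {x : L} (hx : K⟮x⟯ = ⊤) (c₁ c₂ : K) :
    normRing K v t (x - algebraMap K L c₁) < normRing K v t (x - algebraMap K L c₂) ↔
      v (x - algebraMap K L c₂) < v (x - algebraMap K L c₁) := by
  rw [lt_iff_le_not_ge, lt_iff_le_not_ge, normRing_sub_le_iff hdef hp ht hx,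
    normRing_sub_le_iff hdef hp ht hx]

theorem normRing_sub_total (hdef : IsDefectExtension K v) (hp : (Module.finrank K L).Prime)
    (ht : IsValueSection K v t) {x : L} (hx : K⟮x⟯ = ⊤) (c₁ c₂ : K) :
    normRing K v t (x - algebraMap K L c₁) ≤ normRing K v t (x - algebraMap K L c₂) ∨
      normRing K v t (x - algebraMap K L c₂) ≤ normRing K v t (x - algebraMap K L c₁) := by
  rw [normRing_sub_le_iff hdef hp ht hx, normRing_sub_le_iff hdef hp ht hx]
  exact le_total _ _

/-- Membership for all sufficiently close `c`, not merely for one, allows further closeness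
conditions on `c` to be imposed. -/
theorem eventually_mem_normRing_sub (hdef : IsDefectExtension K v)
    (hp : (Module.finrank K L).Prime) (ht : IsValueSection K v t) {x : L} (hx : K⟮x⟯ = ⊤)
    {z : L} (hz : v z ≤ 1) :
    ∀ᶠ c in approxFilter K v x, z ∈ normRing K v t (x - algebraMap K L c) := by
  obtain ⟨he, hf⟩ := hdef.index_eq_one hp
  refine eventually_mem_normRing (g := minpoly K x)
    (hasNoBestApprox he hf (ne_algebraMap_of_adjoin_eq_top hp hx)) ht he
    (by rwa [natDegree_minpoly_of_adjoin_eq_top hx])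
    (fun f hf0 hfx => natDegree_le_natDegree (minpoly.degree_le_of_ne_zero K x hf0 hfx))
    ⟨1, one_ne_zero, Eventually.of_forall fun c => ?_⟩ (exists_aeval_eq_of_adjoin_eq_top hx z) hz
  rw [one_mul]
  exact value_minpoly_eval (hdef.2.1.map_algEquiv he) x c

/-- Two Artin-Schreier generators differ by an affine substitution with a root of unity as
linear coefficient. -/
theorem IsArtinSchreierGenerator.exists_eq {p : ℕ} (h : IsArtinSchreierExtension p K L)
    {ϑ ϑ' : L} (hϑ : IsArtinSchreierGenerator p K ϑ) (hϑ' : IsArtinSchreierGenerator p K ϑ') :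
    ∃ k c : K, k ^ (p - 1) = 1 ∧ ϑ' = algebraMap K L k * (ϑ - algebraMap K L c) := by
  have : Fact p.Prime := ⟨h.prime⟩
  have := h.charP
  have : CharP L p := charP_of_injective_algebraMap (algebraMap K L).injective p
  have hp1 : p ≠ 1 := h.prime.one_lt.ne'
  have hp : (Module.finrank K L).Prime := h.finrank_eq.symm ▸ h.prime
  -- conjugates differ by an element of the prime field
  have key : ∀ y : L, IsArtinSchreierGenerator p K y → ∀ σ : L ≃ₐ[K] L,
      ∃ k : ZMod p, σ y - y = algebraMap K L (ZMod.castHom dvd_rfl K k) := by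
    rintro y ⟨-, b, hb⟩ σ
    have hb' : (σ y) ^ p - σ y = algebraMap K L b := by
      rw [← map_pow, ← map_sub, hb, AlgEquiv.commutes]
    have h1 : (σ y - y) ^ p = σ y - y := by
      rw [sub_pow_char, ← sub_eq_zero]
      linear_combination hb' - hb
    obtain ⟨k, hk⟩ := exists_zmod_of_pow_eq_self h1
    exact ⟨k, by rw [← hk, ← RingHom.comp_apply]; congr 1; exact RingHom.ext_zmod _ _⟩
  -- The Galois group has prime order, so any nontrivial `σ` generates it.
  have hfix : ∀ (σ : L ≃ₐ[K] L) (y : L), σ ≠ 1 → σ y = y → ∃ c : K, algebraMap K L c = y := by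
    intro σ y hσ hy
    have : Fact (Nat.card (L ≃ₐ[K] L)).Prime := ⟨by rwa [IsGalois.card_aut_eq_finrank]⟩
    have hall : ∀ τ : L ≃ₐ[K] L, τ y = y := by
      intro τ
      have h1 : τ ∈ Subgroup.zpowers σ := mem_zpowers_of_prime_card rfl hσ
      have h2 : Subgroup.zpowers σ ≤ MulAction.stabilizer (L ≃ₐ[K] L) y := by
        rw [Subgroup.zpowers_le]
        exact hy
      exact h2 h1
    exact IntermediateField.mem_bot.1 ((IsGalois.mem_bot_iff_fixed y).2 hall)
  have : Nontrivial (L ≃ₐ[K] L) := by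
    rw [← Finite.one_lt_card_iff_nontrivial, IsGalois.card_aut_eq_finrank]
    exact hp.one_lt
  obtain ⟨σ, hσ⟩ := exists_ne (1 : L ≃ₐ[K] L)
  have hne : ∀ y : L, IsArtinSchreierGenerator p K y → σ y - y ≠ 0 := by
    intro y hy h0
    obtain ⟨c, hc⟩ := hfix σ y hσ (sub_eq_zero.1 h0)
    exact ne_algebraMap_of_adjoin_eq_top hp hy.1 c hc.symm
  obtain ⟨m, hm⟩ := key ϑ hϑ σ
  obtain ⟨n, hn⟩ := key ϑ' hϑ' σ
  have hm0 : m ≠ 0 := by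
    rintro rfl
    exact hne ϑ hϑ (by simpa using hm)
  have hn0 : n ≠ 0 := by
    rintro rfl
    exact hne ϑ' hϑ' (by simpa using hn)
  -- `σ` translates `ϑ` by `m` and `ϑ'` by `n`; the ratio `n / m` is the `k` for which `σ` fixes `ϑ'
  -- - k * ϑ`.
  obtain ⟨k, hk⟩ : ∃ k : K, k = ZMod.castHom dvd_rfl K (n / m) := ⟨_, rfl⟩
  have hk0 : k ≠ 0 := by
    rw [hk, Ne, map_eq_zero]
    exact div_ne_zero hn0 hm0
  have hkm : k * ZMod.castHom dvd_rfl K m = ZMod.castHom dvd_rfl K n := by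
    rw [hk, ← map_mul, div_mul_cancel₀ _ hm0]
  obtain ⟨c, hc⟩ := hfix σ (ϑ' - algebraMap K L k * ϑ) hσ (by
    have h1 := congrArg (algebraMap K L) hkm
    rw [map_mul, ← hm, ← hn] at h1
    rw [map_sub, map_mul, AlgEquiv.commutes]
    linear_combination -h1)
  refine ⟨k, -c / k, ?_, ?_⟩
  · rw [hk, ← map_pow, ZMod.pow_card_sub_one_eq_one (div_ne_zero hn0 hm0), map_one]
  · have hk0' : algebraMap K L k ≠ 0 := by simpa using hk0
    rw [map_div₀, map_neg, hc]
    field_simp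
    ring

end PrimeDegree

/-! ### The two cases of the theorem -/

section PrimeDegree

variable {K L Γ₀ : Type*} [Field K] [Field L] [Algebra K L]
  [LinearOrderedCommGroupWithZero Γ₀] {v : Valuation L Γ₀} {t : Γ₀ → K}

theorem isArtinSchreierGenerator_sub {p : ℕ} (h : IsArtinSchreierExtension p K L) {ϑ : L}
    (hϑ : IsArtinSchreierGenerator p K ϑ) (c : K) :
    IsArtinSchreierGenerator p K (ϑ - algebraMap K L c) := by
  have : Fact p.Prime := ⟨h.prime⟩
  have := h.charP
  have : CharP L p := charP_of_injective_algebraMap (algebraMap K L).injective p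
  obtain ⟨hgen, b, hb⟩ := hϑ
  refine ⟨adjoin_sub_algebraMap_eq_top hgen c, b - c ^ p + c, ?_⟩
  rw [sub_pow_char, map_add, map_sub, map_pow]
  linear_combination hb

/-- The scaling factor between generators is a root of unity, hence of value `1`, and does not
affect the ring. This reduces the family of all generators to the translates of one. -/
theorem IsArtinSchreierGenerator.exists_normRing_eq (hdef : IsDefectExtension K v) {p : ℕ}
    (h : IsArtinSchreierExtension p K L) (ht : IsValueSection K v t)
    {ϑ ϑ' : L} (hϑ : IsArtinSchreierGenerator p K ϑ) (hϑ' : IsArtinSchreierGenerator p K ϑ') :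
    ∃ c : K, normRing K v t ϑ' = normRing K v t (ϑ - algebraMap K L c) := by
  have := hdef.1
  have := h.isGalois
  have hp : (Module.finrank K L).Prime := h.finrank_eq.symm ▸ h.prime
  obtain ⟨he, -⟩ := hdef.index_eq_one hp
  obtain ⟨k, c, hk, hkc⟩ := hϑ.exists_eq h hϑ'
  have hp1 : p - 1 ≠ 0 := by have := h.prime.two_le; omega
  have hk0 : k ≠ 0 := by
    rintro rfl
    rw [zero_pow hp1] at hk
    exact zero_ne_one hk
  have hk0' : algebraMap K L k ≠ 0 := by simpa using hk0
  have hvk : v (algebraMap K L k) = 1 := by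
    rw [← pow_eq_one_iff_of_nonneg zero_le hp1, ← map_pow, ← map_pow, hk, map_one, map_one]
  have h0 : ϑ' ≠ 0 := by simpa using ne_algebraMap_of_adjoin_eq_top hp hϑ'.1 0
  have h1 : ϑ - algebraMap K L c ≠ 0 :=
    sub_ne_zero.2 (ne_algebraMap_of_adjoin_eq_top hp hϑ.1 c)
  refine ⟨c, le_antisymm (normRing_le_normRing ht he h0 h1 (k := k) (b := 0) ?_ ?_)
    (normRing_le_normRing ht he h1 h0 (k := k⁻¹) (b := 0) ?_ ?_)⟩
  · rw [hkc, map_zero, add_zero]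
  · rw [hkc]
  · rw [hkc, map_zero, add_zero, map_inv₀, inv_mul_cancel_left₀ hk0']
  · rw [hkc, map_inv₀, inv_mul_cancel_left₀ hk0']

/-- The Artin-Schreier case. -/
theorem artinSchreier_normRing (hdef : IsDefectExtension K v) {p : ℕ}
    (ht : IsValueSection K v t) {ϑ : L} (h : IsArtinSchreierExtension p K L)
    (hϑ : IsArtinSchreierGenerator p K ϑ) :
    (IsChain (· ≤ ·)
          {R : Subring L | ∃ c : K,
            R = normRing K v t (ϑ - algebraMap K L c)} ∧
        (⋃ c : K, (normRing K v t (ϑ - algebraMap K L c) : Set L)) =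
          (v.valuationSubring : Set L)) ∧
      (IsChain (· ≤ ·)
          {R : Subring L | ∃ ϑ' : L, IsArtinSchreierGenerator p K ϑ' ∧
            R = normRing K v t ϑ'} ∧
        (⋃ ϑ' ∈ {x : L | IsArtinSchreierGenerator p K x},
            (normRing K v t ϑ' : Set L)) =
          (v.valuationSubring : Set L)) ∧
      ∀ c₁ c₂ : K,
        normRing K v t (ϑ - algebraMap K L c₁) <
            normRing K v t (ϑ - algebraMap K L c₂) ↔
          v (ϑ - algebraMap K L c₂) < v (ϑ - algebraMap K L c₁) := by
  have := hdef.1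
  have := h.isGalois
  have hp : (Module.finrank K L).Prime := h.finrank_eq.symm ▸ h.prime
  refine ⟨⟨?_, ?_⟩, ⟨?_, ?_⟩, normRing_sub_lt_iff hdef hp ht hϑ.1⟩
  · rintro _ ⟨c₁, rfl⟩ _ ⟨c₂, rfl⟩ -
    exact normRing_sub_total hdef hp ht hϑ.1 c₁ c₂
  · refine Set.Subset.antisymm (Set.iUnion_subset fun c => ?_) fun z hz => ?_
    · exact normRing_le_of_adjoin_eq_top hdef hp ht (adjoin_sub_algebraMap_eq_top hϑ.1 c)
    · obtain ⟨c, hc⟩ := (eventually_mem_normRing_sub hdef hp ht hϑ.1 hz).exists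
      exact Set.mem_iUnion.2 ⟨c, hc⟩
  · rintro _ ⟨ϑ₁, h₁, rfl⟩ _ ⟨ϑ₂, h₂, rfl⟩ -
    obtain ⟨c₁, e₁⟩ := hϑ.exists_normRing_eq hdef h ht h₁
    obtain ⟨c₂, e₂⟩ := hϑ.exists_normRing_eq hdef h ht h₂
    rw [e₁, e₂]
    exact normRing_sub_total hdef hp ht hϑ.1 c₁ c₂
  · refine Set.Subset.antisymm (Set.iUnion₂_subset fun y hy => ?_) fun z hz => ?_
    · exact normRing_le_of_adjoin_eq_top hdef hp ht hy.1
    · obtain ⟨c, hc⟩ := (eventually_mem_normRing_sub hdef hp ht hϑ.1 hz).exists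
      exact Set.mem_iUnion₂.2 ⟨_, isArtinSchreierGenerator_sub h hϑ c, hc⟩

/-- The Kummer case. -/
theorem kummer_normRing (hdef : IsDefectExtension K v) {p : ℕ}
    (ht : IsValueSection K v t) {η : L} (h : IsKummerExtension p K L)
    (hη : IsKummerGenerator p K η) (h1 : IsOneUnit v η) :
    (IsChain (· ≤ ·)
          {R : Subring L | ∃ c : K,
            IsOneUnit (restrictVal K v) c ∧
            R = normRing K v t (η - algebraMap K L c)} ∧
        (⋃ c ∈ {x : K | IsOneUnit (restrictVal K v) x},
            (normRing K v t (η - algebraMap K L c) : Set L)) =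
          (v.valuationSubring : Set L)) ∧
      ∀ c₁ c₂ : K, IsOneUnit (restrictVal K v) c₁ →
        IsOneUnit (restrictVal K v) c₂ →
          (normRing K v t (η - algebraMap K L c₁) <
              normRing K v t (η - algebraMap K L c₂) ↔
            v (η - algebraMap K L c₂) < v (η - algebraMap K L c₁)) := by
  have := hdef.1
  have := h.isGalois
  have hp : (Module.finrank K L).Prime := h.finrank_eq.symm ▸ h.prime
  refine ⟨⟨?_, ?_⟩, fun c₁ c₂ _ _ => normRing_sub_lt_iff hdef hp ht hη.1 c₁ c₂⟩
  · rintro _ ⟨c₁, -, rfl⟩ _ ⟨c₂, -, rfl⟩ -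
    exact normRing_sub_total hdef hp ht hη.1 c₁ c₂
  · refine Set.Subset.antisymm (Set.iUnion₂_subset fun c _ => ?_) fun z hz => ?_
    · exact normRing_le_of_adjoin_eq_top hdef hp ht (adjoin_sub_algebraMap_eq_top hη.1 c)
    · obtain ⟨he, hf⟩ := hdef.index_eq_one hp
      have hx := hasNoBestApprox he hf (ne_algebraMap_of_adjoin_eq_top hp hη.1)
      -- Requiring `c` to be closer to `η` than `1` is makes `c - 1 = (η - 1) - (η - c)` of value
      -- below `1`, so `c` is a 1-unit.
      obtain ⟨c, hc, hlt⟩ := ((eventually_mem_normRing_sub hdef hp ht hη.1 hz).and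
        (hx.eventually_lt 1)).exists
      refine Set.mem_iUnion₂.2 ⟨c, ?_, hc⟩
      change v (algebraMap K L (c - 1)) < 1
      change v (η - 1) < 1 at h1
      rw [map_one] at hlt
      have e : algebraMap K L (c - 1) = (η - 1) - (η - algebraMap K L c) := by
        rw [map_sub, map_one]; ring
      rw [e]
      exact (v.map_sub _ _).trans_lt (max_lt h1 (hlt.trans h1))

end PrimeDegree

end DefectExtension

theorem mainTheorem6 {K L Γ₀ : Type*} [Field K] [Field L] [Algebra K L]
    [LinearOrderedCommGroupWithZero Γ₀] (v : Valuation L Γ₀)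
    (hdef : DefectExtension.IsDefectExtension K v) (p : ℕ)
    (t : Γ₀ → K) (ht : DefectExtension.IsValueSection K v t) :
    (∀ ϑ : L, DefectExtension.IsArtinSchreierExtension p K L →
      DefectExtension.IsArtinSchreierGenerator p K ϑ →
        (IsChain (· ≤ ·)
            {R : Subring L | ∃ c : K,
              R = DefectExtension.normRing K v t (ϑ - algebraMap K L c)} ∧
          (⋃ c : K, (DefectExtension.normRing K v t (ϑ - algebraMap K L c) : Set L)) =
            (v.valuationSubring : Set L)) ∧
        (IsChain (· ≤ ·)
            {R : Subring L | ∃ ϑ' : L, DefectExtension.IsArtinSchreierGenerator p K ϑ' ∧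
              R = DefectExtension.normRing K v t ϑ'} ∧
          (⋃ ϑ' ∈ {x : L | DefectExtension.IsArtinSchreierGenerator p K x},
              (DefectExtension.normRing K v t ϑ' : Set L)) =
            (v.valuationSubring : Set L)) ∧
        ∀ c₁ c₂ : K,
          DefectExtension.normRing K v t (ϑ - algebraMap K L c₁) <
              DefectExtension.normRing K v t (ϑ - algebraMap K L c₂) ↔
            v (ϑ - algebraMap K L c₂) < v (ϑ - algebraMap K L c₁)) ∧
    (∀ η : L, DefectExtension.IsKummerExtension p K L →
      DefectExtension.IsKummerGenerator p K η → DefectExtension.IsOneUnit v η →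
        (IsChain (· ≤ ·)
            {R : Subring L | ∃ c : K,
              DefectExtension.IsOneUnit (DefectExtension.restrictVal K v) c ∧
              R = DefectExtension.normRing K v t (η - algebraMap K L c)} ∧
          (⋃ c ∈ {x : K | DefectExtension.IsOneUnit (DefectExtension.restrictVal K v) x},
              (DefectExtension.normRing K v t (η - algebraMap K L c) : Set L)) =
            (v.valuationSubring : Set L)) ∧
        ∀ c₁ c₂ : K, DefectExtension.IsOneUnit (DefectExtension.restrictVal K v) c₁ →
          DefectExtension.IsOneUnit (DefectExtension.restrictVal K v) c₂ →
            (DefectExtension.normRing K v t (η - algebraMap K L c₁) <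
                DefectExtension.normRing K v t (η - algebraMap K L c₂) ↔
              v (η - algebraMap K L c₂) < v (η - algebraMap K L c₁))) := by
  exact ⟨fun _ => DefectExtension.artinSchreier_normRing hdef ht,
    fun _ => DefectExtension.kummer_normRing hdef ht⟩
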